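/- Let $R$ be an associative ring with identity, not necessarily commutative. Suppose that $R$ is left noetherian and a left FGF-ring, i.e. every finitely generated left $R$-module embeds in a free left $R$-module. Then the following are equivalent: 1. $R$ is a QF-ring (quasi-Frobenius), i.e. $R$ is left and right noetherian and left and right self-injective; 2. $R$ is a WQF-ring (weakly quasi-Frobenius), i.e. the functors $M\mapsto M^*=\operatorname{Hom}_R(M,R)$ define a duality between the categories of finitely presented left and finitely presented right $R$-modules: $M^*$ is finitely presented and the canonical map $M\to M^{**}$ is an isomorphism for every finitely presented left or right $R$-module $M$; 3. $R$ is left FP-injective, i.e. $\operatorname{Ext}^1_R(F,{}_RR)=0$ for every finitely presented left $R$-module $F$; 4. $R$ is a right Kasch ring, i.e. the injective hull $E(R_R)$ of the right module $R_R$ is an injective cogenerator in the category of right $R$-modules; 5. $R$ is semiregular, i.e. $R/\operatorname{rad} R$ is von Neumann regular, where $\operatorname{rad} R$ is the Jacobson radical; 6. $R$ is left semiartinian or right semiartinian, where $R$ is called left (right) semiartinian if every non-zero cyclic left (right) $R$-module has a non-zero socle; 7. $\operatorname{soc}({}_RR)$, the sum of all simple left ideals, is an essential submodule of ${}_RR$.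 -/

import Mathlib

universe u

/- Conventions. Rings are associative with identity, not necessarily commutative. A left `R`-module
is a `Module R M`, a right `R`-module is a `Module Rᵐᵒᵖ M`. In particular `R` as a `Module R R` is
the left regular module and `R` as a `Module Rᵐᵒᵖ R` is the right regular module. -/

namespace RingModule

section Modules

/-- A submodule is essential if it meets every non-zero submodule non-trivially. -/
def IsEssential {S : Type u} [Ring S] {M : Type u} [AddCommGroup M] [Module S M]
    (N : Submodule S M) : Prop :=
  ∀ L : Submodule S M, N ⊓ L = ⊥ → L = ⊥

/-- The socle of a module: the sum of its simple submodules. -/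
def socle (S : Type u) [Ring S] (M : Type u) [AddCommGroup M] [Module S M] : Submodule S M :=
  sSup {N : Submodule S M | IsSimpleModule S N}

/-- An `S`-module `M` is FP-injective if `Ext¹(F, M) = 0` for every finitely presented `F`. -/
def IsFPInjective (S : Type u) [Ring S] (M : Type u) [AddCommGroup M] [Module S M] : Prop :=
  ∀ (F : Type u) [AddCommGroup F] [Module S F], Module.FinitePresentation S F →
    Subsingleton (CategoryTheory.Abelian.Ext.{u} (ModuleCat.of S F) (ModuleCat.of S M) 1)

/-- `E`, together with the embedding `i : M → E`, is an injective hull of the `S`-module `M`. -/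
def IsInjectiveHull {S : Type u} [Ring S] {M E : Type u} [AddCommGroup M] [Module S M]
    [AddCommGroup E] [Module S E] (i : M →ₗ[S] E) : Prop :=
  Module.Injective S E ∧ Function.Injective i ∧ IsEssential (LinearMap.range i)

/-- An `S`-module `E` is a cogenerator if for every non-zero `f : M → N` there is `g : N → E`
with `g f ≠ 0`. -/
def IsCogenerator (S : Type u) [Ring S] (E : Type u) [AddCommGroup E] [Module S E] : Prop :=
  ∀ (M N : Type u) [AddCommGroup M] [Module S M] [AddCommGroup N] [Module S N]
    (f : M →ₗ[S] N), f ≠ 0 → ∃ g : N →ₗ[S] E, g ∘ₗ f ≠ 0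

/-- Every non-zero cyclic `S`-module has non-zero socle. For `S = R` this says that `R` is left
semiartinian, for `S = Rᵐᵒᵖ` that `R` is right semiartinian. -/
def IsSemiartinian (S : Type u) [Ring S] : Prop :=
  ∀ (M : Type u) [AddCommGroup M] [Module S M], Nontrivial M →
    (∃ x : M, Submodule.span S {x} = ⊤) → socle S M ≠ ⊥

end Modules

section Duality

variable (R : Type u) [Ring R]

/-- For a left module `M`, the canonical map `M → M**`, `m ↦ (f ↦ f m)`. Here
`M* = Hom_R(M, R)` is a right `R`-module through `(f r)(m) = f(m) r`. -/
def leftEval (M : Type u) [AddCommGroup M] [Module R M] :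
    M →ₗ[R] ((M →ₗ[R] R) →ₗ[Rᵐᵒᵖ] R) where
  toFun m :=
    { toFun := fun f => f m
      map_add' := fun _ _ => rfl
      map_smul' := fun _ _ => rfl }
  map_add' m n := by ext f; exact map_add f m n
  map_smul' r m := by ext f; exact map_smul f r m

/-- For a right module `N`, the canonical map `N → N**`, `n ↦ (f ↦ f n)`. Here
`N* = Hom_R(N, R)` is a left `R`-module through `(r f)(n) = r f(n)`. -/
def rightEval (N : Type u) [AddCommGroup N] [Module Rᵐᵒᵖ N] :
    N →ₗ[Rᵐᵒᵖ] ((N →ₗ[Rᵐᵒᵖ] R) →ₗ[R] R) where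
  toFun n :=
    { toFun := fun f => f n
      map_add' := fun _ _ => rfl
      map_smul' := fun _ _ => rfl }
  map_add' m n := by ext f; exact map_add f m n
  map_smul' r m := by ext f; exact map_smul f r m

/-- `R` is weakly quasi-Frobenius: the functors `Hom_R(-, R)` restrict to a duality between the
finitely presented left and the finitely presented right `R`-modules. That is, both functors
preserve finite presentation, and the canonical maps `M → M**` are isomorphisms on
finitely presented left and right modules. -/
def IsWQF : Prop :=
  (∀ (M : Type u) [AddCommGroup M] [Module R M], Module.FinitePresentation R M →
    Module.FinitePresentation Rᵐᵒᵖ (M →ₗ[R] R) ∧ Function.Bijective (leftEval R M)) ∧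
  (∀ (N : Type u) [AddCommGroup N] [Module Rᵐᵒᵖ N], Module.FinitePresentation Rᵐᵒᵖ N →
    Module.FinitePresentation R (N →ₗ[Rᵐᵒᵖ] R) ∧ Function.Bijective (rightEval R N))

/-- `R` is quasi-Frobenius: noetherian and self-injective, on both sides. -/
def IsQF : Prop :=
  (IsNoetherian R R ∧ Module.Injective R R) ∧ (IsNoetherian Rᵐᵒᵖ R ∧ Module.Injective Rᵐᵒᵖ R)

/-- `R` is a left FGF-ring: every finitely generated left module embeds in a free module. -/
def IsLeftFGF : Prop :=
  ∀ (M : Type u) [AddCommGroup M] [Module R M], Module.Finite R M →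
    ∃ (ι : Type u) (f : M →ₗ[R] (ι →₀ R)), Function.Injective f

/-- `R` is right Kasch: the injective hull of `R` as a right module is an injective cogenerator. -/
def IsRightKasch : Prop :=
  ∃ (E : Type u) (_ : AddCommGroup E) (_ : Module Rᵐᵒᵖ E) (i : R →ₗ[Rᵐᵒᵖ] E),
    IsInjectiveHull i ∧ IsCogenerator Rᵐᵒᵖ E

/-- `R` is semiregular: `R / rad R` is von Neumann regular, where `rad R` is the Jacobson
radical. -/
def IsSemiregular : Prop :=
  ∀ a : R ⧸ Ring.jacobson R, ∃ b : R ⧸ Ring.jacobson R, a * b * a = a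

end Duality

end RingModule

namespace RingModule

/-! ### Torsionless modules and matrix forms of linear maps -/

section FGF

variable {R : Type u} [Ring R]

/-! The hub is left self-injectivity. Write `J` for the Jacobson radical. Over a left FGF-ring
finitely generated left modules are torsionless, so every left ideal is a left annihilator; with the
noetherian hypothesis this makes `J` nilpotent. If `R` is also left self-injective, elements with
maximal left annihilator give minimal right ideals modulo `J`, so `R/J` is semisimple and `R` is
left artinian. Finitely presented right modules are then torsionless, which together with the
descending chain condition makes `R` right noetherian, and the FGF property gives Baer's criterion
on the right: `R` is QF (`isQF_of_injective`).

WQF, FP-injectivity and right Kasch each yield left self-injectivity directly. Semiregularity,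
either semiartinian condition and an essential socle yield that `R` is left artinian. It remains to
see that a left artinian left FGF-ring is left self-injective (`injective_of_isArtinianRing`).
Finitely generated modules with simple essential socle `S` embed in `R`, so one of them, `U(S)`, has
maximal length; it is injective, hence a summand of `R` and projective. Modules `U(S)` with a common
simple quotient have isomorphic socles, and there are finitely many simples, so by counting every
simple is a quotient of some `U(S)`. Hence `R` is an image, and so a summand, of an injective
module. -/

theorem IsLeftFGF.exists_apply_ne_zero (h : IsLeftFGF R) {M : Type u} [AddCommGroup M] [Module R M]
    [hM : Module.Finite R M] {x : M} (hx : x ≠ 0) : ∃ g : M →ₗ[R] R, g x ≠ 0 := by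
  obtain ⟨ι, f, hf⟩ := h M hM
  have : f x ≠ 0 := (map_ne_zero_iff f hf).2 hx
  obtain ⟨i, hi⟩ := Finsupp.ne_iff.1 this
  exact ⟨Finsupp.lapply i ∘ₗ f, hi⟩

/-- Over a left FGF-ring, left ideals are left annihilators. -/
theorem IsLeftFGF.exists_mul_ne_zero (h : IsLeftFGF R) {I : Ideal R} {x : R} (hx : x ∉ I) :
    ∃ c : R, (∀ a ∈ I, a * c = 0) ∧ x * c ≠ 0 := by
  have hx' : I.mkQ x ≠ 0 := by simpa [Submodule.Quotient.mk_eq_zero] using hx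
  obtain ⟨g, hg⟩ := h.exists_apply_ne_zero hx'
  have key (a : R) : a * g (I.mkQ 1) = g (I.mkQ a) := by
    rw [← smul_eq_mul, ← map_smul, ← map_smul, smul_eq_mul, mul_one]
  refine ⟨g (I.mkQ 1), fun a ha => ?_, by rwa [key]⟩
  rw [key, Submodule.mkQ_apply, (Submodule.Quotient.mk_eq_zero I).2 ha, map_zero]

theorem leftLinearMap_pi_apply {n : ℕ} (f : (Fin n → R) →ₗ[R] R) (z : Fin n → R) :
    f z = ∑ i, z i * f (Pi.single i 1) := by
  conv_lhs => rw [pi_eq_sum_univ' z]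
  simp [map_sum]

theorem rightLinearMap_pi_apply {n : ℕ} (f : (Fin n → R) →ₗ[Rᵐᵒᵖ] R) (z : Fin n → R) :
    f z = ∑ i, f (Pi.single i 1) * z i := by
  have : z = ∑ i, MulOpposite.op (z i) • (Pi.single i 1 : Fin n → R) := by
    ext j
    simp [Finset.sum_apply, Pi.single_apply]
  conv_lhs => rw [this]
  simp [map_sum]

/-- `z ↦ ∑ z i * d i`. -/
def rowDot {n : ℕ} (d : Fin n → R) : (Fin n → R) →ₗ[R] R where
  toFun z := ∑ i, z i * d i
  map_add' x y := by simp [add_mul, Finset.sum_add_distrib]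
  map_smul' r x := by simp [Finset.mul_sum, mul_assoc]

/-- `z ↦ ∑ c i * z i`. -/
def colDot {n : ℕ} (c : Fin n → R) : (Fin n → R) →ₗ[Rᵐᵒᵖ] R where
  toFun z := ∑ i, c i * z i
  map_add' x y := by simp [mul_add, Finset.sum_add_distrib]
  map_smul' r x := by simp [Finset.sum_mul, mul_assoc]

instance : Module.Finite Rᵐᵒᵖ R :=
  ⟨⟨{1}, by
    rw [eq_top_iff]
    intro x _
    rw [Finset.coe_singleton, Submodule.mem_span_singleton]
    exact ⟨MulOpposite.op x, by simp⟩⟩⟩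

/-- `R ≃ Rᵐᵒᵖ` as right modules. -/
def opRightEquiv (R : Type u) [Ring R] : R ≃ₗ[Rᵐᵒᵖ] Rᵐᵒᵖ where
  toFun := MulOpposite.op
  invFun := MulOpposite.unop
  map_add' _ _ := rfl
  map_smul' _ _ := rfl
  left_inv _ := rfl
  right_inv _ := rfl

instance : Module.FinitePresentation Rᵐᵒᵖ R :=
  Module.FinitePresentation.of_equiv (opRightEquiv R).symm

end FGF

/-! ### FP-injectivity versus injectivity -/

section Ext

open CategoryTheory Abelian

variable {R : Type u} [Ring R]

/-- Each `R ⧸ I` is finitely presented, so the obstruction in `Ext¹(R ⧸ I, R)` to extending a map `I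
→ R` vanishes, and Baer's criterion applies. -/
theorem injective_of_isFPInjective [IsNoetherianRing R] (h : IsFPInjective R R) :
    Module.Injective R R := by
  refine Module.Baer.injective fun I g => ?_
  have hsub := h (R ⧸ I) (Module.finitePresentation_of_finite R _)
  let S : ShortComplex (ModuleCat.{u} R) :=
    ShortComplex.mk (ModuleCat.ofHom I.subtype) (ModuleCat.ofHom I.mkQ) (by
      ext x; simp [Submodule.Quotient.mk_eq_zero])
  have hS : S.ShortExact :=
    { exact := by
        rw [ShortComplex.ShortExact.moduleCat_exact_iff_function_exact]
        exact LinearMap.exact_iff.2 (by simp [S])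
      mono_f := (ModuleCat.mono_iff_injective _).2 I.injective_subtype
      epi_g := (ModuleCat.epi_iff_surjective _).2 I.mkQ_surjective }
  obtain ⟨x, hx⟩ := Ext.contravariant_sequence_exact₁ hS
    (Y := ModuleCat.of R R) (Ext.mk₀ (ModuleCat.ofHom g)) (n₁ := 1) rfl (hsub.elim _ _)
  obtain ⟨f, rfl⟩ := Ext.homEquiv₀.symm.surjective x
  have hx' : Ext.mk₀ (S.f ≫ f) = Ext.mk₀ (ModuleCat.ofHom g) := by
    rw [← hx, Ext.homEquiv₀_symm_apply, Ext.mk₀_comp_mk₀]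
  have hfg := Ext.homEquiv₀.symm.injective hx'
  exact ⟨f.hom, fun y hy => by
    simpa [S] using congrArg (fun k => k.hom (⟨y, hy⟩ : I)) hfg⟩

theorem isFPInjective_of_injective [Module.Injective R R] : IsFPInjective R R := by
  intro F _ _ _
  have : Injective (ModuleCat.of R R) := Module.injective_object_of_injective_module R R
  exact subsingleton_of_forall_eq 0 Ext.eq_zero_of_injective

end Ext

/-! ### Right modules over left self-injective and left FGF-rings -/

section RightModules

variable {R : Type u} [Ring R]

/-- A linear map vanishing on the kernel of `f` factors through `f`, for an injective target. -/
theorem exists_comp_eq_of_ker_le {S : Type u} [Ring S] {E X Y : Type u} [AddCommGroup E]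
    [Module S E] [AddCommGroup X] [Module S X] [AddCommGroup Y] [Module S Y]
    [Module.Injective S E] (f : X →ₗ[S] Y) (g : X →ₗ[S] E)
    (hfg : LinearMap.ker f ≤ LinearMap.ker g) : ∃ h : Y →ₗ[S] E, ∀ x, h (f x) = g x := by
  have hinj : Function.Injective ((LinearMap.ker f).liftQ f le_rfl) := by
    rw [← LinearMap.ker_eq_bot, Submodule.ker_liftQ_eq_bot _ _ _ le_rfl]
  obtain ⟨h, hh⟩ := Module.Injective.out _ hinj ((LinearMap.ker f).liftQ g hfg)
  exact ⟨h, fun x => by simpa using hh (Submodule.Quotient.mk x)⟩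

/-- The right linear map `R → N` sending `1` to `x`. -/
def rightSpan {N : Type u} [AddCommGroup N] [Module Rᵐᵒᵖ N] (x : N) : R →ₗ[Rᵐᵒᵖ] N :=
  LinearMap.toSpanSingleton Rᵐᵒᵖ N x ∘ₗ (opRightEquiv R).toLinearMap

@[simp] theorem rightSpan_apply {N : Type u} [AddCommGroup N] [Module Rᵐᵒᵖ N] (x : N) (r : R) :
    rightSpan x r = MulOpposite.op r • x := rfl

theorem exists_fin_rightLinearMap_surjective (N : Type u) [AddCommGroup N] [Module Rᵐᵒᵖ N]
    [Module.Finite Rᵐᵒᵖ N] : ∃ (n : ℕ) (p : (Fin n → R) →ₗ[Rᵐᵒᵖ] N), Function.Surjective p := by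
  obtain ⟨n, p, hp⟩ := Module.Finite.exists_fin' Rᵐᵒᵖ N
  let e := LinearEquiv.piCongrRight (fun _ : Fin n => opRightEquiv R)
  exact ⟨n, p ∘ₗ e.toLinearMap, hp.comp e.surjective⟩

/-- Over a left self-injective ring, finitely presented right modules are torsionless. -/
theorem exists_rightLinearMap_apply_ne_zero [Module.Injective R R] {N : Type u} [AddCommGroup N]
    [Module Rᵐᵒᵖ N] [Module.FinitePresentation Rᵐᵒᵖ N] {x : N} (hx : x ≠ 0) :
    ∃ g : N →ₗ[Rᵐᵒᵖ] R, g x ≠ 0 := by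
  obtain ⟨n, p, hp⟩ := exists_fin_rightLinearMap_surjective (R := R) N
  obtain ⟨y, rfl⟩ := hp x
  obtain ⟨m, k, hk⟩ := Submodule.fg_iff_exists_fin_generating_family.1
    (Module.FinitePresentation.fg_ker p hp)
  -- A functional on `N` is a vector `c` killing the relations `k j`. If every such `c` also killed
  -- `y`, then `B` would factor through `A` by injectivity, making `y` a right combination of the
  -- relations.
  let A : (Fin n → R) →ₗ[R] (Fin m → R) := LinearMap.pi fun j => rowDot (k j)
  let B : (Fin n → R) →ₗ[R] R := rowDot y
  obtain ⟨c, hcA, hcB⟩ : ∃ c, A c = 0 ∧ B c ≠ 0 := by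
    by_contra! hAB
    obtain ⟨h, hh⟩ := exists_comp_eq_of_ker_le A B hAB
    refine hx ?_
    have hy : y = ∑ j, MulOpposite.op (h (Pi.single j 1)) • k j := by
      ext i
      have := hh (Pi.single i 1)
      rw [leftLinearMap_pi_apply] at this
      simp only [Finset.sum_apply, Pi.smul_apply, MulOpposite.smul_eq_mul_unop,
        MulOpposite.unop_op]
      simpa [A, B, rowDot, Pi.single_apply] using this.symm
    rw [← LinearMap.mem_ker, ← hk, hy]
    exact Submodule.sum_mem _ fun j _ => Submodule.smul_mem _ _ (Submodule.subset_span ⟨j, rfl⟩)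
  have hker : LinearMap.ker p ≤ LinearMap.ker (colDot c) := by
    rw [← hk, Submodule.span_le]
    rintro _ ⟨j, rfl⟩
    exact congrFun hcA j
  refine ⟨(LinearMap.ker p).liftQ (colDot c) hker ∘ₗ
    (p.quotKerEquivOfSurjective hp).symm.toLinearMap, ?_⟩
  have : (p.quotKerEquivOfSurjective hp).symm (p y) = Submodule.Quotient.mk y := by
    rw [LinearEquiv.symm_apply_eq]; rfl
  rw [LinearMap.comp_apply, LinearEquiv.coe_coe, this, Submodule.liftQ_apply]
  exact hcB

/-- Over a left FGF-ring, right linear maps to `R` extend from finitely generated right ideals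
to `R`. -/
theorem IsLeftFGF.exists_extend_rightIdeal (h : IsLeftFGF R) {I : Submodule Rᵐᵒᵖ R} (hI : I.FG)
    (g : I →ₗ[Rᵐᵒᵖ] R) : ∃ c : R, ∀ x : I, g x = c * x := by
  obtain ⟨n, a, rfl⟩ := Submodule.fg_iff_exists_fin_generating_family.1 hI
  have ha (i : Fin n) : a i ∈ Submodule.span Rᵐᵒᵖ (Set.range a) := Submodule.subset_span ⟨i, rfl⟩
  let b : Fin n → R := fun i => g ⟨a i, ha i⟩
  -- If the value vector `b` is a left multiple `c • a`, then `g` is multiplication by `c`.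
  -- Otherwise some functional kills `a` but not `b`; its coefficients form a relation among the `a
  -- i`, which `g` must carry over to the `b i`.
  by_cases hb : b ∈ Submodule.span R {a}
  · obtain ⟨c, hc⟩ := Submodule.mem_span_singleton.1 hb
    refine ⟨c, fun x => ?_⟩
    obtain ⟨x, hx⟩ := x
    induction hx using Submodule.span_induction with
    | mem x hx =>
      obtain ⟨i, rfl⟩ := hx
      exact (congrFun hc i).symm
    | zero => exact (map_zero g).trans (mul_zero c).symm
    | add x y hx hy ihx ihy =>
      have := map_add g ⟨x, hx⟩ ⟨y, hy⟩
      simp only [AddMemClass.mk_add_mk] at this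
      simp only [this, ihx, ihy, mul_add]
    | smul r x hx ihx =>
      have := map_smul g r ⟨x, hx⟩
      simp only [SetLike.mk_smul_mk] at this
      rw [this, ihx]
      exact mul_assoc _ _ _
  · obtain ⟨f, hf⟩ := h.exists_apply_ne_zero (x := (Submodule.span R {a}).mkQ b)
      (by simpa [Submodule.Quotient.mk_eq_zero] using hb)
    let f' := f ∘ₗ (Submodule.span R {a}).mkQ
    have hfa : f' a = 0 := by
      have : (Submodule.span R {a}).mkQ a = 0 :=
        (Submodule.Quotient.mk_eq_zero _).2 (Submodule.mem_span_singleton_self a)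
      simp only [f', LinearMap.comp_apply, this, map_zero]
    refine absurd ?_ hf
    change f' b = 0
    rw [leftLinearMap_pi_apply] at hfa ⊢
    have : ∑ i, b i * f' (Pi.single i 1) =
        g (∑ i, MulOpposite.op (f' (Pi.single i 1)) • ⟨a i, ha i⟩) := by
      rw [map_sum]
      exact Finset.sum_congr rfl fun i _ => (map_smul g _ _).symm
    rw [this]
    convert map_zero g
    ext
    simpa using hfa

end RightModules

/-! ### Duality and the WQF condition -/

section Duality

variable {R : Type u} [Ring R]

theorem isNoetherianRing_mulOpposite (h : IsNoetherian Rᵐᵒᵖ R) : IsNoetherianRing Rᵐᵒᵖ :=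
  isNoetherian_of_linearEquiv (opRightEquiv R)

theorem rightModule_baer_injective
    (h : ∀ (I : Submodule Rᵐᵒᵖ R) (g : I →ₗ[Rᵐᵒᵖ] R), ∃ c : R, ∀ x : I, g x = c * x) :
    Module.Injective Rᵐᵒᵖ R := by
  refine Module.Baer.injective fun I g => ?_
  let e : R →ₗ[Rᵐᵒᵖ] Rᵐᵒᵖ := opRightEquiv R
  let g' : Submodule.comap e I →ₗ[Rᵐᵒᵖ] R :=
    g ∘ₗ (e.restrict (p := Submodule.comap e I) (q := I) fun x hx => hx)
  obtain ⟨c, hc⟩ := h _ g'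
  refine ⟨LinearMap.toSpanSingleton Rᵐᵒᵖ R c, fun x hx => ?_⟩
  exact (hc ⟨x.unop, hx⟩).symm

theorem exists_fin_leftLinearMap_surjective (M : Type u) [AddCommGroup M] [Module R M]
    [Module.Finite R M] : ∃ (n : ℕ) (v : Fin n → M) (p : (Fin n → R) →ₗ[R] M),
      Function.Surjective p ∧ ∀ c, p c = ∑ i, c i • v i := by
  obtain ⟨n, p, hp⟩ := Module.Finite.exists_fin' R M
  refine ⟨n, fun i => p (Pi.single i 1), p, hp, fun c => ?_⟩
  conv_lhs => rw [pi_eq_sum_univ' c]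
  simp [map_sum]

/-- Evaluation of functionals on a left module at a family of elements. -/
def leftEvalFamily {M : Type u} [AddCommGroup M] [Module R M] {n : ℕ} (v : Fin n → M) :
    (M →ₗ[R] R) →ₗ[Rᵐᵒᵖ] (Fin n → R) where
  toFun f i := f (v i)
  map_add' _ _ := rfl
  map_smul' _ _ := rfl

/-- Evaluation of functionals on a right module at a family of elements. -/
def rightEvalFamily {N : Type u} [AddCommGroup N] [Module Rᵐᵒᵖ N] {n : ℕ} (v : Fin n → N) :
    (N →ₗ[Rᵐᵒᵖ] R) →ₗ[R] (Fin n → R) where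
  toFun f i := f (v i)
  map_add' _ _ := rfl
  map_smul' _ _ := rfl

theorem finite_leftDual (h : IsNoetherian Rᵐᵒᵖ R) (M : Type u) [AddCommGroup M] [Module R M]
    [Module.Finite R M] : Module.Finite Rᵐᵒᵖ (M →ₗ[R] R) := by
  obtain ⟨n, v, p, hp, hv⟩ := exists_fin_leftLinearMap_surjective (R := R) M
  have hinj : Function.Injective (leftEvalFamily (R := R) v) := by
    refine (injective_iff_map_eq_zero _).2 fun f hf => ?_
    ext x
    obtain ⟨c, rfl⟩ := hp x
    have hfv : ∀ i, f (v i) = 0 := fun i => congrFun hf i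
    simp [hv, hfv]
  exact Module.Finite.of_injective _ hinj

theorem exists_fin_right_generators (N : Type u) [AddCommGroup N] [Module Rᵐᵒᵖ N]
    [Module.Finite Rᵐᵒᵖ N] : ∃ (n : ℕ) (v : Fin n → N),
      ∀ x, ∃ c : Fin n → R, x = ∑ i, MulOpposite.op (c i) • v i := by
  obtain ⟨n, v, p, hp, hv⟩ := exists_fin_leftLinearMap_surjective (R := Rᵐᵒᵖ) N
  refine ⟨n, v, fun x => ?_⟩
  obtain ⟨c, rfl⟩ := hp x
  exact ⟨fun i => (c i).unop, hv c⟩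

theorem rightEvalFamily_injective {N : Type u} [AddCommGroup N] [Module Rᵐᵒᵖ N] {n : ℕ}
    {v : Fin n → N} (hv : ∀ x, ∃ c : Fin n → R, x = ∑ i, MulOpposite.op (c i) • v i) :
    Function.Injective (rightEvalFamily (R := R) v) := by
  refine (injective_iff_map_eq_zero _).2 fun f hf => ?_
  ext x
  obtain ⟨c, rfl⟩ := hv x
  have hfv : ∀ i, f (v i) = 0 := fun i => congrFun hf i
  simp [hfv]

theorem finite_rightDual [IsNoetherianRing R] (N : Type u) [AddCommGroup N] [Module Rᵐᵒᵖ N]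
    [Module.Finite Rᵐᵒᵖ N] : Module.Finite R (N →ₗ[Rᵐᵒᵖ] R) := by
  obtain ⟨n, v, hv⟩ := exists_fin_right_generators (R := R) N
  exact Module.Finite.of_injective _ (rightEvalFamily_injective hv)

/-- Evaluation at `n` generators embeds `M*` in `Rⁿ`. A functional on `M*` extends to `Rⁿ`, and its
coefficients there give the combination of generators that represents it. -/
theorem leftEval_surjective [Module.Injective Rᵐᵒᵖ R] (M : Type u) [AddCommGroup M] [Module R M]
    [Module.Finite R M] : Function.Surjective (leftEval R M) := by
  intro φ
  obtain ⟨n, v, p, hp, hv⟩ := exists_fin_leftLinearMap_surjective (R := R) M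
  obtain ⟨h, hh⟩ := exists_comp_eq_of_ker_le (leftEvalFamily (R := R) v) φ (by
    intro f hf
    have hf0 : f = 0 := by
      ext x
      obtain ⟨c, rfl⟩ := hp x
      have hfv : ∀ i, f (v i) = 0 := fun i => congrFun hf i
      simp [hv, hfv]
    rw [hf0]; exact zero_mem _)
  refine ⟨∑ i, h (Pi.single i 1) • v i, ?_⟩
  ext f
  rw [← hh f, rightLinearMap_pi_apply]
  simp [leftEval, leftEvalFamily, map_sum]

theorem rightEval_surjective [Module.Injective R R] (N : Type u) [AddCommGroup N]
    [Module Rᵐᵒᵖ N] [Module.Finite Rᵐᵒᵖ N] : Function.Surjective (rightEval R N) := by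
  intro φ
  obtain ⟨n, v, hv⟩ := exists_fin_right_generators (R := R) N
  obtain ⟨h, hh⟩ := Module.Injective.out _ (rightEvalFamily_injective hv) φ
  refine ⟨∑ i, MulOpposite.op (h (Pi.single i 1)) • v i, ?_⟩
  ext f
  rw [← hh f, leftLinearMap_pi_apply]
  simp [rightEval, rightEvalFamily, map_sum]

theorem IsLeftFGF.isWQF_of_isQF (h : IsLeftFGF R) (hR : IsQF R) : IsWQF R := by
  obtain ⟨⟨hln, hli⟩, hrn, hri⟩ := hR
  have : IsNoetherianRing R := hln
  have := isNoetherianRing_mulOpposite hrn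
  refine ⟨fun M _ _ hM => ⟨?_, ?_, leftEval_surjective M⟩,
    fun N _ _ hN => ⟨?_, ?_, rightEval_surjective N⟩⟩
  · have := finite_leftDual hrn M
    exact Module.finitePresentation_of_finite _ _
  · refine (injective_iff_map_eq_zero _).2 fun x hx => ?_
    by_contra hx0
    obtain ⟨g, hg⟩ := h.exists_apply_ne_zero hx0
    exact hg (LinearMap.congr_fun hx g)
  · have := finite_rightDual (R := R) N
    exact Module.finitePresentation_of_finite _ _
  · refine (injective_iff_map_eq_zero _).2 fun x hx => ?_
    by_contra hx0
    obtain ⟨g, hg⟩ := exists_rightLinearMap_apply_ne_zero (R := R) hx0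
    exact hg (LinearMap.congr_fun hx g)

/-- Restriction of functionals to a left ideal. -/
def restrictDual (I : Ideal R) : (R →ₗ[R] R) →ₗ[Rᵐᵒᵖ] (I →ₗ[R] R) where
  toFun f := f ∘ₗ I.subtype
  map_add' _ _ := rfl
  map_smul' _ _ := rfl

/-- The cokernel `C` of restriction `R* → I*` has zero dual: by reflexivity a functional on `I*` is
evaluation at some `x ∈ I`, and if it kills restrictions, testing on the inclusion gives `x = 0`.
Since `C → C**` is injective, `C = 0`, which is Baer's criterion. -/
theorem IsWQF.injective [IsNoetherianRing R] (h : IsWQF R) : Module.Injective R R := by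
  refine Module.Baer.injective fun I g => ?_
  have hI := Module.finitePresentation_of_finite R I
  obtain ⟨hId, hIe⟩ := h.1 I hI
  have hRd := (h.1 R inferInstance).1
  let C := (I →ₗ[R] R) ⧸ LinearMap.range (restrictDual I)
  have hC : Module.FinitePresentation Rᵐᵒᵖ C := by
    refine Module.finitePresentation_of_surjective _ (Submodule.mkQ_surjective _) ?_
    rw [Submodule.ker_mkQ, LinearMap.range_eq_map]
    exact (Module.Finite.fg_top).map _
  have hzero (φ : C →ₗ[Rᵐᵒᵖ] R) : φ = 0 := by
    obtain ⟨x, hx⟩ := hIe.2 (φ ∘ₗ Submodule.mkQ _)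
    have hev (f : I →ₗ[R] R) : f x = φ (Submodule.Quotient.mk f) := LinearMap.congr_fun hx f
    have hx0 : x = 0 := by
      have h1 := hev (restrictDual I LinearMap.id)
      rw [(Submodule.Quotient.mk_eq_zero _).2 (LinearMap.mem_range_self _ _), map_zero] at h1
      exact Subtype.ext h1
    refine Submodule.linearMap_qext _ ?_
    ext f
    have := hev f
    rw [hx0, map_zero] at this
    exact this.symm
  have hg : (Submodule.Quotient.mk g : C) = 0 := by
    refine (h.2 C hC).2.1 ?_
    ext φ
    rw [hzero φ]
    rfl
  obtain ⟨f, hf⟩ := (Submodule.Quotient.mk_eq_zero _).1 hg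
  exact ⟨f, fun x hx => LinearMap.congr_fun hf ⟨x, hx⟩⟩

/-! ### The right Kasch condition -/

theorem IsQF.isRightKasch (hR : IsQF R) : IsRightKasch R := by
  obtain ⟨⟨hln, hli⟩, hrn, hri⟩ := hR
  have := isNoetherianRing_mulOpposite hrn
  refine ⟨R, inferInstance, inferInstance, LinearMap.id, ⟨hri, fun _ _ h => h, ?_⟩, ?_⟩
  · intro L hL
    simpa using hL
  · intro M N _ _ _ _ f hf
    obtain ⟨m, hm⟩ : ∃ m, f m ≠ 0 := by
      by_contra! h
      exact hf (LinearMap.ext h)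
    let P := Submodule.span Rᵐᵒᵖ {f m}
    have hP : Module.FinitePresentation Rᵐᵒᵖ P := Module.finitePresentation_of_finite _ _
    let x : P := ⟨f m, Submodule.mem_span_singleton_self _⟩
    obtain ⟨g, hg⟩ := exists_rightLinearMap_apply_ne_zero (R := R) (x := x)
      (fun h => hm (congrArg Subtype.val h))
    obtain ⟨k, hk⟩ := Module.Injective.out P.subtype P.injective_subtype g
    exact ⟨k, fun h0 => hg ((hk x).symm.trans (LinearMap.congr_fun h0 m))⟩

/-- For a maximal right ideal `P ⊇ N`, the simple module `R ⧸ P` maps nontrivially to the hull. Its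
image meets the essential submodule `R`, hence lies in it, and the image of `1` is the required
multiplier. -/
theorem IsRightKasch.exists_mul_eq_zero (hR : IsRightKasch R) {N : Submodule Rᵐᵒᵖ R}
    (hN : N ≠ ⊤) : ∃ c : R, c ≠ 0 ∧ ∀ x ∈ N, c * x = 0 := by
  obtain ⟨E, _, _, i, ⟨-, hi, hess⟩, hE⟩ := hR
  obtain ⟨P, hP, hNP⟩ := (eq_top_or_exists_le_coatom N).resolve_left hN
  have : IsSimpleModule Rᵐᵒᵖ (R ⧸ P) := isSimpleModule_iff_isCoatom.2 hP
  have hid : (LinearMap.id : (R ⧸ P) →ₗ[Rᵐᵒᵖ] (R ⧸ P)) ≠ 0 := by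
    intro h
    have := IsSimpleModule.nontrivial Rᵐᵒᵖ (R ⧸ P)
    obtain ⟨x, hx⟩ := exists_ne (0 : R ⧸ P)
    exact hx (LinearMap.congr_fun h x)
  obtain ⟨g, hg⟩ := hE _ _ LinearMap.id hid
  rw [LinearMap.comp_id] at hg
  have hL : LinearMap.range i ⊓ LinearMap.range g ≠ ⊥ := fun h =>
    hg (LinearMap.range_eq_bot.1 (hess _ h))
  obtain ⟨y, ⟨⟨c, rfl⟩, ⟨t, ht⟩⟩, hy0⟩ := Submodule.exists_mem_ne_zero_of_ne_bot hL
  obtain ⟨s, rfl⟩ := P.mkQ_surjective t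
  have hs : P.mkQ s ≠ 0 := fun h => hy0 (by rw [← ht, h, map_zero])
  obtain ⟨r, hr⟩ := IsSimpleModule.toSpanSingleton_surjective Rᵐᵒᵖ hs (P.mkQ 1)
  have hc : g (P.mkQ 1) = i (r • c) := by
    rw [← hr, LinearMap.toSpanSingleton_apply, map_smul, ht, map_smul]
  have hmul (x : R) : i (r • c * x) = g (P.mkQ x) := by
    have h1 : r • c * x = MulOpposite.op x • (r • c) := rfl
    rw [h1, map_smul, ← hc, ← map_smul, ← map_smul]
    simp
  refine ⟨r • c, fun h0 => hg ?_, fun x hx => hi ?_⟩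
  · refine LinearMap.ext fun t => ?_
    obtain ⟨x, rfl⟩ := P.mkQ_surjective t
    have := hmul x
    rw [h0, zero_mul, map_zero] at this
    exact this.symm
  · rw [hmul, Submodule.mkQ_apply, (Submodule.Quotient.mk_eq_zero _).2 (hNP hx)]
    simp

/-- A finitely generated module which splits off from every finitely generated module containing it
is injective. -/
theorem injective_of_splits {U : Type u} [AddCommGroup U] [Module R U] [Module.Finite R U]
    (h : ∀ (M : Type u) [AddCommGroup M] [Module R M] [Module.Finite R M] (j : U →ₗ[R] M),
      Function.Injective j → ∃ r : M →ₗ[R] U, ∀ x, r (j x) = x) :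
    Module.Injective R U := by
  refine Module.Baer.injective fun I g => ?_
  -- The quotient by `W` is the pushout of `U ← I → R`; a retraction onto `U`, restricted to `R`,
  -- extends `g`.
  let W : Submodule R (U × R) := LinearMap.range (g.prod (-I.subtype))
  let j : U →ₗ[R] (U × R) ⧸ W := W.mkQ ∘ₗ LinearMap.inl R U R
  obtain ⟨r, hr⟩ := h _ j (by
    refine (injective_iff_map_eq_zero _).2 fun x hx => ?_
    obtain ⟨y, hy⟩ := (Submodule.Quotient.mk_eq_zero W).1 hx
    have h2 : -(y : R) = 0 := congrArg Prod.snd hy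
    have h1 : g y = x := congrArg Prod.fst hy
    have hy0 : y = 0 := Subtype.ext (neg_eq_zero.1 h2)
    rw [← h1, hy0, map_zero])
  refine ⟨r ∘ₗ W.mkQ ∘ₗ LinearMap.inr R U R, fun x hx => ?_⟩
  rw [← hr (g ⟨x, hx⟩)]
  refine congrArg r ((Submodule.Quotient.eq W).2 ⟨-⟨x, hx⟩, ?_⟩)
  ext <;> simp

/-- If `R ⊆ M` and `M` embeds in a free module, let `a` be the image of `1`. A nonzero `c` killing
all coordinates of `a` would contradict injectivity, so these coordinates generate `R` as a right
ideal. Writing `1` in terms of them gives a retraction `M → R`. -/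
theorem IsLeftFGF.injective_of_isRightKasch (h : IsLeftFGF R) (hR : IsRightKasch R) :
    Module.Injective R R := by
  refine injective_of_splits fun M _ _ hM j hj => ?_
  obtain ⟨ι, f, hf⟩ := h M hM
  let a := f (j 1)
  have ha (c : R) : f (j c) = c • a := by rw [← map_smul, ← map_smul, smul_eq_mul, mul_one]
  have htop : Submodule.span Rᵐᵒᵖ (Set.range a) = ⊤ := by
    by_contra hne
    obtain ⟨c, hc0, hc⟩ := hR.exists_mul_eq_zero hne
    refine hc0 (hj (hf ?_))
    rw [ha, map_zero, map_zero]
    ext i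
    exact hc _ (Submodule.subset_span ⟨i, rfl⟩)
  obtain ⟨b, hb⟩ := Finsupp.mem_span_range_iff_exists_finsupp.1
    (htop ▸ Submodule.mem_top : (1 : R) ∈ Submodule.span Rᵐᵒᵖ (Set.range a))
  let r : (ι →₀ R) →ₗ[R] R :=
    ∑ i ∈ b.support, LinearMap.toSpanSingleton R R (b i).unop ∘ₗ Finsupp.lapply i
  refine ⟨r ∘ₗ f, fun x => ?_⟩
  have hr : r a = 1 := by
    rw [← hb]
    simp [r, Finsupp.sum, LinearMap.sum_apply]
  rw [LinearMap.comp_apply, ha, map_smul, hr, smul_eq_mul, mul_one]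

end Duality

/-! ### Nilpotent radical and criteria for semisimplicity -/

section Semisimple

/-- The right annihilator of a two-sided ideal, as a left ideal. -/
def rightAnnihilator {R : Type u} [Ring R] (I : Ideal R) [I.IsTwoSided] : Ideal R where
  carrier := {c | ∀ a ∈ I, a * c = 0}
  add_mem' hx hy a ha := by rw [mul_add, hx a ha, hy a ha, add_zero]
  zero_mem' a _ := mul_zero a
  smul_mem' r c hc a ha := by
    rw [smul_eq_mul, ← mul_assoc]
    exact hc _ (Ideal.IsTwoSided.mul_mem_of_left r ha)

/-- The right annihilators of the powers `J ^ n` are an ascending chain of left ideals, so they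
stabilize. Left ideals are determined by their right annihilators, so the powers stabilize too, and
Nakayama finishes. -/
theorem IsLeftFGF.isNilpotent_jacobson {R : Type u} [Ring R] [IsNoetherianRing R]
    (h : IsLeftFGF R) : IsNilpotent (Ring.jacobson R) := by
  let J := Ring.jacobson R
  obtain ⟨n, hn⟩ := monotone_stabilizes_iff_noetherian.2 (inferInstance : IsNoetherian R R)
    ⟨fun n => rightAnnihilator (J ^ n), fun m n hmn c hc a ha => hc a (Ideal.pow_le_pow_right hmn ha)⟩
  have hle : J ^ n ≤ J ^ (n + 1) := by
    intro x hx
    by_contra hx'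
    obtain ⟨c, hc, hxc⟩ := h.exists_mul_ne_zero hx'
    have hcn : c ∈ rightAnnihilator (J ^ n) := by
      have : rightAnnihilator (J ^ n) = rightAnnihilator (J ^ (n + 1)) := hn (n + 1) n.le_succ
      exact this ▸ hc
    exact hxc (hcn x hx)
  refine ⟨n, Submodule.FG.eq_bot_of_le_jacobson_smul (IsNoetherian.noetherian _) ?_⟩
  exact hle.trans (Ideal.IsTwoSided.pow_succ n).le

/-- If every nonzero right ideal of a semiprime left noetherian ring contains a minimal right ideal,
the ring is semisimple. -/
theorem isSemisimpleRing_of_minimal_rightIdeals {S : Type u} [Ring S] [IsNoetherianRing S]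
    (hsp : ∀ a : S, (∀ s, a * s * a = 0) → a = 0)
    (hmin : ∀ x : S, x ≠ 0 → ∃ y, x * y ≠ 0 ∧ ∀ z, x * y * z ≠ 0 → ∃ w, x * y * z * w = x * y) :
    IsSemisimpleRing S := by
  let A : Submodule Sᵐᵒᵖ S := sSup {N | IsSimpleModule Sᵐᵒᵖ N}
  have hAmul {a : S} (ha : a ∈ A) (b : S) : a * b ∈ A := A.smul_mem (MulOpposite.op b) ha
  -- Take `Se` maximal with `e` an idempotent in the right socle `A`. If `e ≠ 1`, a minimal right
  -- ideal inside `(1 - e)S` provides an idempotent that enlarges `Se`. Hence `1 ∈ A`.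
  let P : Set (Ideal S) := {I | ∃ e ∈ A, e * e = e ∧ I = Ideal.span {e}}
  obtain ⟨I, ⟨e, heA, he, rfl⟩, hI⟩ := set_has_maximal_iff_noetherian.2
    (inferInstance : IsNoetherian S S) P ⟨_, 0, zero_mem _, mul_zero 0, rfl⟩
  have he1 : e = 1 := by
    by_contra hne
    obtain ⟨y, hy0, hy⟩ := hmin (1 - e) (sub_ne_zero.2 (Ne.symm hne))
    set t := (1 - e) * y with ht
    have het : e * t = 0 := by rw [ht, ← mul_assoc, mul_sub, mul_one, he, sub_self, zero_mul]
    obtain ⟨s, hs⟩ : ∃ s, t * s * t ≠ 0 := by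
      by_contra! h0
      exact hy0 (hsp t h0)
    obtain ⟨w, hw⟩ := hy (s * t) (by rwa [← mul_assoc])
    have hw : t * s * t * w = t := by rwa [mul_assoc t s t]
    -- Brauer's lemma: `t * s` fixes `f` on the right, so it kills `f * f - f`. A nonzero `f * f -
    -- f` would generate the minimal right ideal `tS`, forcing `t * s * t = 0`.
    let f := t * w * s
    have huf : t * s * f = t * s := by
      calc t * s * f = (t * s * t * w) * s := by simp only [f, mul_assoc]
        _ = t * s := by rw [hw]
    have hff : f * f = f := by
      by_contra hff
      have hv0 : f * f - f ≠ 0 := sub_ne_zero.2 hff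
      have hv : t * (w * s * f - w * s) = f * f - f := by
        simp only [f, mul_sub, mul_assoc]
      obtain ⟨z, hz⟩ := hy (w * s * f - w * s) (by rwa [hv])
      refine hs ?_
      have : t * s * (f * f - f) = 0 := by
        rw [mul_sub, ← mul_assoc, huf, huf, sub_self]
      have hzt : t = (f * f - f) * z := by rw [← hv, hz]
      calc t * s * t = t * s * ((f * f - f) * z) := by rw [← hzt]
        _ = t * s * (f * f - f) * z := by simp only [mul_assoc]
        _ = 0 := by rw [this, zero_mul]
    have hef : e * f = 0 := by
      simp only [f, ← mul_assoc, het, zero_mul]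
    have hf0 : f ≠ 0 := by
      intro h0
      rw [h0, mul_zero] at huf
      exact hs (by rw [← huf, zero_mul])
    have htA : t ∈ A := by
      have hsimple : IsSimpleModule Sᵐᵒᵖ (Submodule.span Sᵐᵒᵖ {t}) := by
        rw [isSimpleModule_iff_toSpanSingleton_surjective]
        refine ⟨⟨⟨⟨t, Submodule.mem_span_singleton_self t⟩, 0,
          fun h0 => hy0 (congrArg Subtype.val h0)⟩⟩, ?_⟩
        rintro ⟨x, hx⟩ hx0 ⟨x', hx'⟩
        obtain ⟨a, rfl⟩ := Submodule.mem_span_singleton.1 hx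
        obtain ⟨b, rfl⟩ := Submodule.mem_span_singleton.1 hx'
        obtain ⟨w', hw'⟩ := hy a.unop (fun h0 => hx0 (Subtype.ext h0))
        refine ⟨MulOpposite.op (w' * b.unop), Subtype.ext ?_⟩
        change t * a.unop * (w' * b.unop) = t * b.unop
        rw [← mul_assoc, hw']
      exact (le_sSup (a := Submodule.span Sᵐᵒᵖ {t}) hsimple)
        (Submodule.mem_span_singleton_self t)
    have hfA : f ∈ A := by
      have := hAmul htA (w * s)
      rwa [← mul_assoc] at this
    -- This makes the idempotent orthogonal to `e` on both sides, so `e + f'` is again idempotent.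
    let f' := f * (1 - e)
    have hf'e : f' * e = 0 := by simp only [f', mul_assoc, sub_mul, one_mul, he, sub_self, mul_zero]
    have hef' : e * f' = 0 := by simp only [f', ← mul_assoc, hef, zero_mul]
    have hf'f : f' * f = f := by
      simp only [f', mul_assoc, sub_mul, one_mul, hef, sub_zero, hff]
    have hf'f' : f' * f' = f' := by
      change f' * (f * (1 - e)) = f * (1 - e)
      rw [← mul_assoc, hf'f]
    have hf'0 : f' ≠ 0 := fun h0 => hf0 (by rw [← hf'f, h0, zero_mul])
    refine hI (Ideal.span {e + f'}) ⟨e + f', add_mem heA (hAmul hfA _), ?_, rfl⟩ ?_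
    · simp [mul_add, add_mul, he, hef', hf'e, hf'f']
    · refine lt_of_le_of_ne ?_ ?_
      · rw [Ideal.span_singleton_le_iff_mem, Ideal.mem_span_singleton']
        exact ⟨e, by rw [mul_add, he, hef', add_zero]⟩
      · intro heq
        have : f' ∈ Ideal.span {e + f'} :=
          Ideal.mem_span_singleton'.2 ⟨f', by rw [mul_add, hf'e, hf'f', zero_add]⟩
        rw [← heq, Ideal.mem_span_singleton'] at this
        obtain ⟨b, hb⟩ := this
        refine hf'0 ?_
        rw [← hf'e, ← hb, mul_assoc, he]
  have hA : A = ⊤ := by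
    refine eq_top_iff.2 fun x _ => ?_
    have := hAmul heA x
    rwa [he1, one_mul] at this
  have : IsSemisimpleModule Sᵐᵒᵖ S := sSup_simples_eq_top_iff_isSemisimpleModule.1 hA
  have : IsSemisimpleModule Sᵐᵒᵖ Sᵐᵒᵖ := IsSemisimpleModule.congr (opRightEquiv S).symm
  exact isSemisimpleRing_mulOpposite_iff.1 this

/-- A left noetherian von Neumann regular ring is semisimple. -/
theorem isSemisimpleRing_of_regular {S : Type u} [Ring S] [IsNoetherianRing S]
    (h : ∀ a : S, ∃ b, a * b * a = a) : IsSemisimpleRing S := by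
  refine (isSemisimpleModule_iff S S).2 ⟨fun (I : Ideal S) => ?_⟩
  let P : Set (Ideal S) := {K | ∃ e ∈ I, e * e = e ∧ K = Ideal.span {e}}
  obtain ⟨K, ⟨e, heI, he, rfl⟩, hK⟩ := set_has_maximal_iff_noetherian.2
    (inferInstance : IsNoetherian S S) P ⟨_, 0, zero_mem _, mul_zero 0, rfl⟩
  -- If `b = a - a * e ≠ 0`, regularity gives an idempotent `g` generating `Sb`. Then `g' = (1 - e)
  -- * g` is orthogonal to `e`, and `e + g'` contradicts maximality.
  have hIe (a : S) (ha : a ∈ I) : a * e = a := by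
    by_contra hne
    set b := a - a * e with hb
    have hb0 : b ≠ 0 := sub_ne_zero.2 (Ne.symm hne)
    have hbI : b ∈ I := sub_mem ha (I.mul_mem_left _ heI)
    have hbe : b * e = 0 := by rw [hb, sub_mul, mul_assoc, he, sub_self]
    obtain ⟨c, hc⟩ := h b
    let g := c * b
    have hbg : b * g = b := by rw [← mul_assoc, hc]
    have hgg : g * g = g := by simp only [g, mul_assoc, hbg]
    have hge : g * e = 0 := by rw [mul_assoc, hbe, mul_zero]
    let g' := g - e * g
    have hg'g : g' * g = g' := by simp only [g', sub_mul, mul_assoc, hgg]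
    have hg'e : g' * e = 0 := by simp only [g', sub_mul, mul_assoc, hge, mul_zero, sub_self]
    have heg' : e * g' = 0 := by simp only [g', mul_sub, ← mul_assoc, he, sub_self]
    have hgg' : g * g' = g := by simp only [g', mul_sub, ← mul_assoc, hge, hgg, zero_mul, sub_zero]
    have hg'g' : g' * g' = g' := by
      change g' * (g - e * g) = g'
      rw [mul_sub, ← mul_assoc g' e g, hg'g, hg'e, zero_mul, sub_zero]
    refine hK (Ideal.span {e + g'}) ⟨e + g', add_mem heI
      (sub_mem (I.mul_mem_left _ hbI) (I.mul_mem_left _ (I.mul_mem_left _ hbI))), ?_, rfl⟩ ?_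
    · simp [mul_add, add_mul, he, heg', hg'e, hg'g']
    · refine lt_of_le_of_ne ?_ ?_
      · rw [Ideal.span_singleton_le_iff_mem, Ideal.mem_span_singleton']
        exact ⟨e, by rw [mul_add, he, heg', add_zero]⟩
      · intro heq
        have : b ∈ Ideal.span {e + g'} := Ideal.mem_span_singleton'.2
          ⟨b, by rw [mul_add, hbe, zero_add]; conv_lhs => rw [← hbg, mul_assoc, hgg', hbg]⟩
        rw [← heq, Ideal.mem_span_singleton'] at this
        obtain ⟨d, hd⟩ := this
        refine hb0 ?_
        rw [← hbe, ← hd, mul_assoc, he]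
  refine ⟨Ideal.span {1 - e}, ?_⟩
  rw [isCompl_iff, disjoint_iff, codisjoint_iff]
  constructor
  · refine eq_bot_iff.2 fun x hx => ?_
    obtain ⟨hxI, hx⟩ := hx
    obtain ⟨c, rfl⟩ := Ideal.mem_span_singleton'.1 hx
    have := hIe _ hxI
    rw [mul_assoc, sub_mul, one_mul, he, sub_self, mul_zero] at this
    rw [← this]
    exact zero_mem _
  · rw [Ideal.eq_top_iff_one, Submodule.mem_sup]
    exact ⟨e, heI, 1 - e, Ideal.mem_span_singleton_self _, by abel⟩

/-- Semisimple rings are von Neumann regular. -/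
theorem exists_mul_mul_eq_of_isSemisimpleRing {S : Type u} [Ring S] [IsSemisimpleRing S] (a : S) :
    ∃ b, a * b * a = a := by
  obtain ⟨K, hK⟩ := exists_isCompl (Ideal.span {a})
  obtain ⟨x, hx, k, hk, hxk⟩ := Submodule.mem_sup.1
    (show (1 : S) ∈ Ideal.span {a} ⊔ K by rw [hK.sup_eq_top]; trivial)
  obtain ⟨b, rfl⟩ := Ideal.mem_span_singleton'.1 hx
  have hak : a * (b * a) + a * k = a := by rw [← mul_add, hxk, mul_one]
  have h0 : a * k ∈ Ideal.span {a} ⊓ K := by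
    refine ⟨?_, K.mul_mem_left _ hk⟩
    rw [eq_sub_of_add_eq' hak]
    exact sub_mem (Ideal.mem_span_singleton_self a)
      (Ideal.mul_mem_left _ _ (Ideal.mul_mem_left _ _ (Ideal.mem_span_singleton_self a)))
  rw [hK.inf_eq_bot] at h0
  rw [(Submodule.mem_bot S).1 h0, add_zero, ← mul_assoc] at hak
  exact ⟨b, hak⟩

/-- Here `(y * a)² = 0`, so `1 - y * a` inverts `1 + y * a` for every `y`, and `a` lies in the
radical. -/
theorem eq_zero_of_mul_mul_eq_zero {S : Type u} [Ring S] (hS : Ring.jacobson S = ⊥) (a : S)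
    (ha : ∀ s, a * s * a = 0) : a = 0 := by
  have : a ∈ Ideal.jacobson (⊥ : Ideal S) := by
    refine Ideal.mem_jacobson_iff.2 fun y => ⟨1 - y * a, ?_⟩
    have h2 := ha y
    have : (1 - y * a) * y * a + (1 - y * a) - 1 = -(y * (a * y * a)) := by noncomm_ring
    rw [this, h2]
    simp
  rw [Ideal.jacobson_bot, hS] at this
  exact this

end Semisimple

/-! ### Chain conditions from injectivity and from socles -/

section Artinian

variable {R : Type u} [Ring R]

theorem IsLeftFGF.isArtinianRing_of_isSemisimpleRing [hn : IsNoetherianRing R] (h : IsLeftFGF R)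
    (hs : IsSemisimpleRing (R ⧸ Ring.jacobson R)) : IsArtinianRing R :=
  have : IsSemiprimaryRing R := ⟨hs, h.isNilpotent_jacobson⟩
  IsSemiprimaryRing.isNoetherian_iff_isArtinian.1 hn

theorem isSemisimpleRing_quotient_jacobson [IsNoetherianRing R]
    (h : ∀ x ∉ Ring.jacobson R, ∃ y, x * y ∉ Ring.jacobson R ∧
      ∀ z, x * y * z ∉ Ring.jacobson R → ∃ w, x * y * z * w - x * y ∈ Ring.jacobson R) :
    IsSemisimpleRing (R ⧸ Ring.jacobson R) := by
  let π := Ideal.Quotient.mk (Ring.jacobson R)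
  have hπ (x : R) : π x ≠ 0 ↔ x ∉ Ring.jacobson R := Ideal.Quotient.eq_zero_iff_mem.not
  have : IsNoetherianRing (R ⧸ Ring.jacobson R) :=
    isNoetherianRing_of_surjective _ _ π Ideal.Quotient.mk_surjective
  refine isSemisimpleRing_of_minimal_rightIdeals
    (eq_zero_of_mul_mul_eq_zero (Ring.jacobson_quotient_jacobson R)) fun x hx => ?_
  obtain ⟨x, rfl⟩ := Ideal.Quotient.mk_surjective x
  obtain ⟨y, hy, hxy⟩ := h x ((hπ x).1 hx)
  refine ⟨π y, (hπ (x * y)).2 hy, fun z hz => ?_⟩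
  obtain ⟨z, rfl⟩ := Ideal.Quotient.mk_surjective z
  obtain ⟨w, hw⟩ := hxy z ((hπ (x * y * z)).1 hz)
  exact ⟨π w, Ideal.Quotient.eq.2 hw⟩

/-- Among multiples `x * y` outside `J` take one with maximal left annihilator. A further multiple
`x * y * z` outside `J` has the same annihilator, so by injectivity some right multiplication sends
it back to `x * y`: the class of `x * y` generates a minimal right ideal. -/
theorem isSemisimpleRing_quotient_jacobson_of_injective [IsNoetherianRing R]
    [Module.Injective R R] : IsSemisimpleRing (R ⧸ Ring.jacobson R) := by
  refine isSemisimpleRing_quotient_jacobson fun x hx => ?_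
  let l (a : R) : Ideal R := LinearMap.ker (LinearMap.toSpanSingleton R R a)
  obtain ⟨_, ⟨y, hy, rfl⟩, hmax⟩ := set_has_maximal_iff_noetherian.2
    (inferInstance : IsNoetherian R R) {I | ∃ y, x * y ∉ Ring.jacobson R ∧ I = l (x * y)}
    ⟨_, 1, by rwa [mul_one], rfl⟩
  refine ⟨y, hy, fun z hz => ?_⟩
  have hle : l (x * y) ≤ l (x * y * z) := by
    intro r hr
    have hr : r * (x * y) = 0 := hr
    change r * (x * y * z) = 0
    rw [← mul_assoc, hr, zero_mul]
  have heq : l (x * y) = l (x * y * z) := by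
    by_contra hne
    exact hmax _ ⟨y * z, by rwa [← mul_assoc], by rw [← mul_assoc]⟩ (lt_of_le_of_ne hle hne)
  obtain ⟨f, hf⟩ := exists_comp_eq_of_ker_le (LinearMap.toSpanSingleton R R (x * y * z))
    (LinearMap.toSpanSingleton R R (x * y)) heq.ge
  refine ⟨f 1, ?_⟩
  have h1 := hf 1
  simp only [LinearMap.toSpanSingleton_apply, one_smul] at h1
  have h2 : f (x * y * z) = x * y * z * f 1 := by
    conv_lhs => rw [← mul_one (x * y * z), ← smul_eq_mul, map_smul, smul_eq_mul]
  rw [← h2, h1, sub_self]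
  exact zero_mem _

theorem exists_isSimpleModule_of_socle_ne_bot {S : Type u} [Ring S] {M : Type u} [AddCommGroup M]
    [Module S M] (h : socle S M ≠ ⊥) : ∃ N : Submodule S M, IsSimpleModule S N := by
  by_contra! h0
  refine h ?_
  rw [socle, sSup_eq_bot]
  exact fun N hN => (h0 N hN).elim

theorem socle_ne_bot_of_isSimpleModule {S : Type u} [Ring S] {M : Type u} [AddCommGroup M]
    [Module S M] {N : Submodule S M} (hN : IsSimpleModule S N) : socle S M ≠ ⊥ := by
  intro h
  have hle : N ≤ socle S M := le_sSup hN
  rw [h, le_bot_iff] at hle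
  exact (isSimpleModule_iff_isAtom.1 hN).1 hle

theorem IsSemiartinian.isSemisimpleRing_quotient_jacobson [IsNoetherianRing R]
    (h : IsSemiartinian Rᵐᵒᵖ) : IsSemisimpleRing (R ⧸ Ring.jacobson R) := by
  refine RingModule.isSemisimpleRing_quotient_jacobson fun x hx => ?_
  -- `R ⧸ K` is the right ideal of `R/J` generated by the class of `x`; a simple submodule of it is
  -- the minimal right ideal sought.
  let K : Submodule Rᵐᵒᵖ R :=
    { carrier := {r | x * r ∈ Ring.jacobson R}
      add_mem' := fun ha hb => by
        simp only [Set.mem_ofPred_eq, mul_add] at *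
        exact add_mem ha hb
      zero_mem' := by simp
      smul_mem' := fun c r hr => by
        simp only [Set.mem_ofPred_eq, MulOpposite.smul_eq_mul_unop] at *
        rw [← mul_assoc]
        exact Ideal.IsTwoSided.mul_mem_of_left _ hr }
  have hK (r : R) : K.mkQ r ≠ 0 ↔ x * r ∉ Ring.jacobson R :=
    (Submodule.Quotient.mk_eq_zero K).not
  have h1 : K.mkQ 1 ≠ 0 := by rw [hK, mul_one]; exact hx
  obtain ⟨N, hN⟩ := exists_isSimpleModule_of_socle_ne_bot
    (h (R ⧸ K) ⟨_, _, h1⟩ ⟨K.mkQ 1, by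
      refine eq_top_iff.2 fun t _ => ?_
      obtain ⟨r, rfl⟩ := K.mkQ_surjective t
      refine Submodule.mem_span_singleton.2 ⟨MulOpposite.op r, ?_⟩
      rw [← map_smul]
      simp⟩)
  have := IsSimpleModule.nontrivial Rᵐᵒᵖ N
  obtain ⟨⟨t, ht⟩, ht0⟩ := exists_ne (0 : N)
  obtain ⟨y, rfl⟩ := K.mkQ_surjective t
  refine ⟨y, (hK y).1 fun h0 => ht0 (Subtype.ext h0), fun z hz => ?_⟩
  let s : N := MulOpposite.op z • ⟨K.mkQ y, ht⟩
  have hs : s ≠ 0 := by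
    intro h0
    rw [mul_assoc, ← hK] at hz
    exact hz (congrArg Subtype.val h0)
  obtain ⟨w, hw⟩ := IsSimpleModule.toSpanSingleton_surjective Rᵐᵒᵖ hs ⟨K.mkQ y, ht⟩
  have hw' : K.mkQ (y * z * w.unop) = K.mkQ y := congrArg Subtype.val hw
  have hmem : y * z * w.unop - y ∈ K := (Submodule.Quotient.eq K).1 hw'
  refine ⟨w.unop, ?_⟩
  have : x * (y * z * w.unop - y) ∈ Ring.jacobson R := hmem
  simpa only [mul_sub, mul_assoc] using this

/-- A maximal artinian left ideal `I` must be `R`: otherwise the preimage of a simple submodule of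
`R ⧸ I` is a larger artinian left ideal. -/
theorem IsSemiartinian.isArtinianRing [IsNoetherianRing R] (h : IsSemiartinian R) :
    IsArtinianRing R := by
  obtain ⟨I, hI, hmax⟩ := set_has_maximal_iff_noetherian.2
    (inferInstance : IsNoetherian R R) {I : Ideal R | IsArtinian R I} ⟨⊥, (inferInstance : IsArtinian R (⊥ : Ideal R))⟩
  have hI : IsArtinian R I := hI
  by_cases htop : I = ⊤
  · subst htop
    exact isArtinian_of_linearEquiv (Submodule.topEquiv (R := R) (M := R))
  · have : Nontrivial (R ⧸ I) := Submodule.Quotient.nontrivial_iff.2 htop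
    obtain ⟨N, hN⟩ := exists_isSimpleModule_of_socle_ne_bot
      (h (R ⧸ I) this ⟨I.mkQ 1, by
        refine eq_top_iff.2 fun t _ => ?_
        obtain ⟨r, rfl⟩ := I.mkQ_surjective t
        refine Submodule.mem_span_singleton.2 ⟨r, ?_⟩
        rw [← map_smul]
        simp⟩)
    let K : Ideal R := N.comap I.mkQ
    have hIK : I ≤ K := by
      intro x hx
      have : I.mkQ x = 0 := (Submodule.Quotient.mk_eq_zero I).2 hx
      rw [Submodule.mem_comap, this]
      exact zero_mem _
    refine absurd (lt_of_le_of_ne hIK fun heq => ?_) (hmax K ?_)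
    · refine (isSimpleModule_iff_isAtom.1 hN).1 (eq_bot_iff.2 fun t ht => ?_)
      obtain ⟨x, rfl⟩ := I.mkQ_surjective t
      have : x ∈ K := ht
      rw [← heq] at this
      exact (Submodule.Quotient.mk_eq_zero I).2 this
    · let p : K →ₗ[R] N := I.mkQ.restrict fun x hx => hx
      refine isArtinian_of_range_eq_ker (Submodule.inclusion hIK) p ?_
      ext x
      rw [Submodule.range_inclusion, Submodule.mem_comap, LinearMap.mem_ker]
      constructor
      · intro hx
        exact Subtype.ext ((Submodule.Quotient.mk_eq_zero I).2 hx)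
      · intro hx
        exact (Submodule.Quotient.mk_eq_zero I).1 (congrArg Subtype.val hx)

theorem exists_isSimpleModule_le_of_socle_inf_ne_bot {M : Type u} [AddCommGroup M] [Module R M]
    {L : Submodule R M} (h : socle R M ⊓ L ≠ ⊥) : ∃ N ≤ L, IsSimpleModule R N := by
  have hsoc : IsSemisimpleModule R (socle R M) := by
    rw [socle, sSup_eq_iSup]
    refine isSemisimpleModule_biSup_of_isSemisimpleModule_submodule fun N hN => ?_
    have : IsSimpleModule R N := hN
    infer_instance
  have : IsSemisimpleModule R (socle R M ⊓ L : Submodule R M) :=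
    IsSemisimpleModule.of_injective (Submodule.inclusion inf_le_left)
      (Submodule.inclusion_injective _)
  obtain h0 | ⟨N, hN, hs⟩ := IsSemisimpleModule.eq_bot_or_exists_simple_le (R := R)
    (socle R M ⊓ L)
  · exact absurd h0 h
  · exact ⟨N, hN.trans inf_le_right, hs⟩

theorem IsLeftFGF.isSemiartinian_of_isEssential_socle (h : IsLeftFGF R)
    (hess : IsEssential (socle R R)) : IsSemiartinian R := by
  intro M _ _ hM hcyc
  obtain ⟨x₀, hx₀⟩ := hcyc
  obtain ⟨ι, f, hf⟩ := h M ⟨⟨{x₀}, by simpa using hx₀⟩⟩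
  -- With minimal support, one nonzero coordinate is already injective on `Rx`, because killing it
  -- shrinks the support. So `Rx` is isomorphic to a nonzero left ideal, which contains a simple
  -- one.
  obtain ⟨x, hx0, hmin⟩ : ∃ x : M, x ≠ 0 ∧ ∀ y ≠ 0, (f x).support.card ≤ (f y).support.card := by
    obtain ⟨x₁, hx₁⟩ := exists_ne (0 : M)
    obtain ⟨x, hx, hm⟩ := WellFounded.has_min
      (InvImage.wf (fun x : M => (f x).support.card) Nat.lt_wfRel.wf) {x | x ≠ 0} ⟨x₁, hx₁⟩
    exact ⟨x, hx, fun y hy => not_lt.1 (hm y hy)⟩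
  have hfx : f x ≠ 0 := (map_ne_zero_iff f hf).2 hx0
  obtain ⟨i, hi⟩ := Finsupp.support_nonempty_iff.2 hfx
  have hinj (r : R) (hr : r * f x i = 0) : r • x = 0 := by
    by_contra hne
    refine (hmin _ hne).not_gt (Finset.card_lt_card ?_)
    rw [map_smul]
    refine Finset.ssubset_iff_subset_ne.2 ⟨Finsupp.support_smul, fun heq => ?_⟩
    rw [← heq, Finsupp.mem_support_iff] at hi
    exact hi hr
  have hL : socle R R ⊓ Ideal.span {f x i} ≠ ⊥ := by
    intro h0
    have : f x i ∈ Ideal.span {f x i} := Ideal.mem_span_singleton_self _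
    rw [hess _ h0] at this
    exact Finsupp.mem_support_iff.1 hi this
  obtain ⟨N, hNL, hN⟩ := exists_isSimpleModule_le_of_socle_inf_ne_bot hL
  have := IsSimpleModule.nontrivial R N
  obtain ⟨⟨n, hn⟩, hn0⟩ := exists_ne (0 : N)
  obtain ⟨r, rfl⟩ := Ideal.mem_span_singleton'.1 (hNL hn)
  have hn0 : r * f x i ≠ 0 := fun h0 => hn0 (Subtype.ext h0)
  refine socle_ne_bot_of_isSimpleModule (N := Submodule.span R {r • x}) ?_
  rw [isSimpleModule_iff_toSpanSingleton_surjective]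
  refine ⟨⟨⟨⟨r • x, Submodule.mem_span_singleton_self _⟩, 0, fun h0 => hn0 ?_⟩⟩, ?_⟩
  · have h0 : r • x = 0 := congrArg Subtype.val h0
    have := DFunLike.congr_fun (congrArg f h0) i
    simpa using this
  · rintro ⟨y, hy⟩ hy0 ⟨y', hy'⟩
    obtain ⟨a, rfl⟩ := Submodule.mem_span_singleton.1 hy
    obtain ⟨b, rfl⟩ := Submodule.mem_span_singleton.1 hy'
    have ha : (⟨a * (r * f x i), N.smul_mem a hn⟩ : N) ≠ 0 := by
      intro h0
      have h0 : a * (r * f x i) = 0 := congrArg Subtype.val h0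
      rw [← mul_assoc] at h0
      refine hy0 (Subtype.ext ?_)
      change a • r • x = 0
      rw [← mul_smul]
      exact hinj _ h0
    obtain ⟨c, hc⟩ := IsSimpleModule.toSpanSingleton_surjective R ha
      ⟨b * (r * f x i), N.smul_mem b hn⟩
    have hc : c * (a * (r * f x i)) = b * (r * f x i) := congrArg Subtype.val hc
    refine ⟨c, Subtype.ext ?_⟩
    change c • a • r • x = b • r • x
    rw [← sub_eq_zero]
    have := hinj (c * (a * r) - b * r) (by
      rw [sub_mul, sub_eq_zero]
      simpa only [mul_assoc] using hc)
    simpa only [sub_smul, mul_smul] using this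

theorem isEssential_socle_of_isArtinian {M : Type u} [AddCommGroup M] [Module R M]
    [IsArtinian R M] : IsEssential (socle R M) := by
  intro L hL
  by_contra hne
  obtain ⟨N, hN, hNL⟩ := (eq_bot_or_exists_atom_le L).resolve_left hne
  have hs : N ≤ socle R M := le_sSup (isSimpleModule_iff_isAtom.2 hN)
  exact hN.1 (le_bot_iff.1 ((le_inf hs hNL).trans hL.le))

/-- The left annihilator of a right ideal. -/
def leftAnnihilator (K : Submodule Rᵐᵒᵖ R) : Ideal R where
  carrier := {c | ∀ a ∈ K, c * a = 0}
  add_mem' hx hy a ha := by rw [add_mul, hx a ha, hy a ha, add_zero]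
  zero_mem' a _ := zero_mul a
  smul_mem' r c hc a ha := by rw [smul_eq_mul, mul_assoc, hc a ha, mul_zero]

/-- Choose a finitely generated `K ≤ I` with minimal left annihilator. If `x ∈ I` were outside `K`,
torsionlessness of the finitely presented `R ⧸ K` would give a multiplier killing `K` but not `x`,
and adjoining `x` would shrink the annihilator. -/
theorem isNoetherian_right_of_injective [IsArtinianRing R] [Module.Injective R R] :
    IsNoetherian Rᵐᵒᵖ R := by
  refine ⟨fun I => ?_⟩
  obtain ⟨_, ⟨K, hK, hKI, rfl⟩, hmin⟩ := IsArtinian.set_has_minimal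
    {L : Ideal R | ∃ K : Submodule Rᵐᵒᵖ R, K.FG ∧ K ≤ I ∧ L = leftAnnihilator K}
    ⟨_, ⊥, Submodule.fg_bot, bot_le, rfl⟩
  suffices h : I ≤ K by rwa [le_antisymm h hKI]
  intro x hx
  by_contra hxK
  have : Module.FinitePresentation Rᵐᵒᵖ (R ⧸ K) :=
    Module.finitePresentation_of_surjective K.mkQ K.mkQ_surjective (by rwa [Submodule.ker_mkQ])
  obtain ⟨g, hg⟩ := exists_rightLinearMap_apply_ne_zero (R := R) (x := K.mkQ x)
    (fun h0 => hxK ((Submodule.Quotient.mk_eq_zero K).1 h0))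
  have hgx (y : R) : g (K.mkQ y) = g (K.mkQ 1) * y := by
    have : g (K.mkQ 1) * y = MulOpposite.op y • g (K.mkQ 1) := rfl
    rw [this, ← map_smul, ← map_smul]
    simp
  refine hmin _ ⟨K ⊔ Submodule.span Rᵐᵒᵖ {x}, hK.sup (Submodule.fg_span_singleton x),
    sup_le hKI ((Submodule.span_singleton_le_iff_mem _ _).2 hx), rfl⟩
    (lt_of_le_of_ne (fun c hc a ha => hc a (le_sup_left (a := K) ha)) fun heq => ?_)
  have hc : g (K.mkQ 1) ∈ leftAnnihilator K := by
    intro a ha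
    have h0 : K.mkQ a = 0 := (Submodule.Quotient.mk_eq_zero K).2 ha
    rw [← hgx, h0, map_zero]
  rw [← heq] at hc
  exact hg ((hgx x).trans (hc x (le_sup_right (a := K) (Submodule.mem_span_singleton_self x))))

theorem IsLeftFGF.isArtinianRing_of_injective [IsNoetherianRing R] [Module.Injective R R]
    (h : IsLeftFGF R) : IsArtinianRing R :=
  h.isArtinianRing_of_isSemisimpleRing isSemisimpleRing_quotient_jacobson_of_injective

theorem IsLeftFGF.isQF_of_injective [hn : IsNoetherianRing R] [hi : Module.Injective R R]
    (h : IsLeftFGF R) : IsQF R := by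
  have := h.isArtinianRing_of_injective
  have hr := isNoetherian_right_of_injective (R := R)
  exact ⟨⟨hn, hi⟩, hr, rightModule_baer_injective fun I g =>
    h.exists_extend_rightIdeal (hr.noetherian I) g⟩

end Artinian

/-! ### Left artinian left FGF-rings are left self-injective -/

section InjectiveHulls

variable {R : Type u} [Ring R]

/-- `S` embeds in `U` so that its image lies in every nonzero submodule of `U`. -/
def EssentiallyEmbeds (R : Type u) [Ring R] (S U : Type u) [AddCommGroup S] [Module R S]
    [AddCommGroup U] [Module R U] : Prop :=
  ∃ j : S →ₗ[R] U, Function.Injective j ∧ ∀ L : Submodule R U, L ≠ ⊥ → LinearMap.range j ≤ L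

/-- A functional nonzero on the image of `S` is injective, since a nonzero kernel would contain that
image. -/
theorem EssentiallyEmbeds.exists_injective_to_ring (h : IsLeftFGF R) {S U : Type u}
    [AddCommGroup S] [Module R S] [AddCommGroup U] [Module R U] [Nontrivial S] [Module.Finite R U]
    (hSU : EssentiallyEmbeds R S U) : ∃ k : U →ₗ[R] R, Function.Injective k := by
  obtain ⟨j, hj, hess⟩ := hSU
  obtain ⟨s, hs⟩ := exists_ne (0 : S)
  obtain ⟨k, hk⟩ := h.exists_apply_ne_zero ((map_ne_zero_iff j hj).2 hs)
  refine ⟨k, LinearMap.ker_eq_bot.1 ?_⟩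
  by_contra hne
  exact hk (hess _ hne (LinearMap.mem_range_self j s))

theorem exists_essentiallyEmbeds_maximal_length [IsArtinianRing R] (h : IsLeftFGF R) (S : Type u)
    [AddCommGroup S] [Module R S] [IsSimpleModule R S] :
    ∃ (U : Type u) (_ : AddCommGroup U) (_ : Module R U), Module.Finite R U ∧
      EssentiallyEmbeds R S U ∧ ∀ (V : Type u) [AddCommGroup V] [Module R V],
        Module.Finite R V → EssentiallyEmbeds R S V → Module.length R V ≤ Module.length R U := by
  have := IsSimpleModule.nontrivial R S
  have hlt : Module.length R R ≠ ⊤ := Module.length_ne_top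
  let T : Set ℕ∞ := {n | ∃ (V : Type u) (_ : AddCommGroup V) (_ : Module R V), Module.Finite R V ∧
    EssentiallyEmbeds R S V ∧ n = Module.length R V}
  have hTb : ∀ n ∈ T, n ≤ Module.length R R := by
    rintro _ ⟨V, _, _, hV, hSV, rfl⟩
    obtain ⟨k, hk⟩ := hSV.exists_injective_to_ring h
    exact Module.length_le_of_injective k hk
  have hT0 : T.Nonempty := ⟨_, S, inferInstance, inferInstance, inferInstance,
    ⟨LinearMap.id, fun _ _ h => h, fun L hL => by
      rw [(eq_bot_or_eq_top L).resolve_left hL]; exact le_top⟩, rfl⟩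
  have hTf : T.Finite := by
    obtain ⟨n, hn⟩ := ENat.ne_top_iff_exists.1 hlt
    refine ((Set.finite_Iic n).image ((↑) : ℕ → ℕ∞)).subset fun m hm => ?_
    have hm' := hTb m hm
    rw [← hn] at hm'
    obtain ⟨k, rfl⟩ := ENat.ne_top_iff_exists.1 (ne_top_of_le_ne_top (ENat.natCast_ne_top n) hm')
    exact ⟨k, by exact_mod_cast hm', rfl⟩
  obtain ⟨m, ⟨U, iU, iU', hU, hSU, rfl⟩, hmax⟩ := hTf.exists_maximal hT0
  refine ⟨U, iU, iU', hU, hSU, fun V _ _ hV hSV => ?_⟩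
  by_contra! hlt'
  exact hlt'.not_ge (hmax ⟨V, inferInstance, inferInstance, hV, hSV, rfl⟩ hlt'.le)

/-- For `U ⊆ M` take `W` maximal with `W ∩ U = 0`. Then `U` is essential in `M ⧸ W`, so `S` still
lies in every nonzero submodule. Maximal length forces `U = M ⧸ W`, so `U` splits off `M`. -/
theorem injective_of_maximal_length [IsArtinianRing R] {S U : Type u} [AddCommGroup S] [Module R S]
    [AddCommGroup U] [Module R U] [IsSimpleModule R S] [Module.Finite R U]
    (hSU : EssentiallyEmbeds R S U)
    (hmax : ∀ (V : Type u) [AddCommGroup V] [Module R V],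
      Module.Finite R V → EssentiallyEmbeds R S V → Module.length R V ≤ Module.length R U) :
    Module.Injective R U := by
  refine injective_of_splits fun M _ _ _ j hj => ?_
  obtain ⟨i, hi, hess⟩ := hSU
  have : IsNoetherian R M := inferInstance
  obtain ⟨W, hW, hWmax⟩ := set_has_maximal_iff_noetherian.2 this
    {W : Submodule R M | W ⊓ LinearMap.range j = ⊥} ⟨⊥, bot_inf_eq _⟩
  have hW : W ⊓ LinearMap.range j = ⊥ := hW
  let q : U →ₗ[R] M ⧸ W := W.mkQ ∘ₗ j
  have hq : Function.Injective q := by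
    refine (injective_iff_map_eq_zero _).2 fun x hx => ?_
    have hx : j x ∈ W ⊓ LinearMap.range j :=
      ⟨(Submodule.Quotient.mk_eq_zero W).1 hx, LinearMap.mem_range_self j x⟩
    rw [hW, Submodule.mem_bot] at hx
    exact hj (hx.trans (map_zero j).symm)
  have hSV : EssentiallyEmbeds R S (M ⧸ W) := by
    refine ⟨q ∘ₗ i, hq.comp hi, fun L hL => ?_⟩
    have hWL : W < L.comap W.mkQ := by
      refine lt_of_le_of_ne (fun x hx => ?_) fun heq => hL ?_
      · have h0 : W.mkQ x = 0 := (Submodule.Quotient.mk_eq_zero W).2 hx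
        rw [Submodule.mem_comap, h0]
        exact zero_mem _
      · refine eq_bot_iff.2 fun t ht => ?_
        obtain ⟨x, rfl⟩ := W.mkQ_surjective t
        have : x ∈ L.comap W.mkQ := ht
        rw [← heq] at this
        exact (Submodule.Quotient.mk_eq_zero W).2 this
    have hne : L.comap q ≠ ⊥ := by
      intro h0
      refine hWmax _ ?_ hWL
      refine eq_bot_iff.2 ?_
      rintro _ ⟨hx, ⟨u, rfl⟩⟩
      have hu : u ∈ L.comap q := hx
      rw [h0, Submodule.mem_bot] at hu
      rw [hu, map_zero]
      exact zero_mem _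
    rw [LinearMap.range_comp, Submodule.map_le_iff_le_comap]
    exact hess _ hne
  have hsurj : Function.Surjective q := by
    rw [← LinearMap.range_eq_top]
    by_contra hne
    have h1 := Submodule.length_lt hne
    rw [← (LinearEquiv.ofInjective q hq).length_eq] at h1
    exact h1.not_ge (hmax _ inferInstance hSV)
  let e := LinearEquiv.ofBijective q ⟨hq, hsurj⟩
  exact ⟨e.symm.toLinearMap ∘ₗ W.mkQ, fun x => e.symm_apply_apply x⟩

theorem exists_projective_injective_essentiallyEmbeds [IsArtinianRing R] (h : IsLeftFGF R)
    (S : Type u) [AddCommGroup S] [Module R S] [IsSimpleModule R S] :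
    ∃ (U : Type u) (_ : AddCommGroup U) (_ : Module R U), Module.Finite R U ∧
      Module.Injective R U ∧ Module.Projective R U ∧ EssentiallyEmbeds R S U := by
  obtain ⟨U, _, _, hU, hSU, hmax⟩ := exists_essentiallyEmbeds_maximal_length h S
  have := IsSimpleModule.nontrivial R S
  have hinj := injective_of_maximal_length hSU hmax
  obtain ⟨k, hk⟩ := hSU.exists_injective_to_ring h
  obtain ⟨r, hr⟩ := Module.Injective.out k hk LinearMap.id
  exact ⟨U, _, _, hU, hinj, Module.Projective.of_split k r (LinearMap.ext hr), hSU⟩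

/-- Projective modules with simple essential socle and a common simple quotient have isomorphic
socles. -/
theorem EssentiallyEmbeds.nonempty_linearEquiv {S S' U U' T : Type u}
    [AddCommGroup S] [Module R S] [AddCommGroup S'] [Module R S'] [AddCommGroup U] [Module R U]
    [AddCommGroup U'] [Module R U'] [AddCommGroup T] [Module R T]
    [IsSimpleModule R S] [IsSimpleModule R S'] [IsSimpleModule R T] [IsNoetherian R U]
    [Module.Projective R U] [Module.Projective R U']
    (hSU : EssentiallyEmbeds R S U) (hSU' : EssentiallyEmbeds R S' U')
    {f : U →ₗ[R] T} (hf : f ≠ 0) {f' : U' →ₗ[R] T} (hf' : f' ≠ 0) : Nonempty (S ≃ₗ[R] S') := by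
  obtain ⟨j, hj, hess⟩ := hSU
  obtain ⟨j', hj', hess'⟩ := hSU'
  have := IsSimpleModule.nontrivial R S
  have := IsSimpleModule.nontrivial R S'
  obtain ⟨s, hs⟩ := exists_ne (0 : S)
  obtain ⟨g, hg⟩ := Module.projective_lifting_property f' f (LinearMap.surjective_of_ne_zero hf')
  obtain ⟨g', hg'⟩ := Module.projective_lifting_property f f' (LinearMap.surjective_of_ne_zero hf)
  -- Fitting's lemma: `k = g' ∘ g` satisfies `f ∘ k = f`, so no power of it is zero. If `g` were not
  -- injective, a kernel and a range of a high power would both be nonzero, hence both contain `S`,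
  -- though they are disjoint.
  have hker : LinearMap.ker g = ⊥ := by
    by_contra hne
    let k : Module.End R U := g' ∘ₗ g
    have hfk : f ∘ₗ k = f := by
      rw [← LinearMap.comp_assoc, hg', hg]
    have hfkn (n : ℕ) : f ∘ₗ (k ^ n) = f := by
      induction n with
      | zero => rfl
      | succ n ih => rw [pow_succ, Module.End.mul_eq_comp, ← LinearMap.comp_assoc, ih, hfk]
    obtain ⟨n, hn⟩ := Filter.eventually_atTop.1 (Module.End.eventually_disjoint_ker_pow_range_pow k)
    have hdis := hn (n + 1) n.le_succ
    have h1 : LinearMap.range j ≤ LinearMap.ker (k ^ (n + 1)) := by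
      refine hess _ fun h0 => hne (eq_bot_iff.2 fun x hx => ?_)
      rw [← h0, LinearMap.mem_ker, pow_succ, Module.End.mul_apply]
      have hx : g x = 0 := hx
      simp [k, hx]
    have h2 : LinearMap.range j ≤ LinearMap.range (k ^ (n + 1)) := by
      refine hess _ fun h0 => hf ?_
      rw [← hfkn (n + 1), LinearMap.range_eq_bot.1 h0, LinearMap.comp_zero]
    have h3 : j s = 0 := (Submodule.mem_bot R).1
      (hdis.le_bot ⟨h1 (LinearMap.mem_range_self j s), h2 (LinearMap.mem_range_self j s)⟩)
    exact hs (hj (h3.trans (map_zero j).symm))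
  have hgj : Function.Injective (g ∘ₗ j) := (LinearMap.ker_eq_bot.1 hker).comp hj
  have hle : LinearMap.range j' ≤ LinearMap.range (g ∘ₗ j) := by
    refine hess' _ fun h0 => hs (hgj ?_)
    rw [LinearMap.range_eq_bot.1 h0]
    rfl
  let e := LinearEquiv.ofInjective (g ∘ₗ j) hgj
  let φ : S' →ₗ[R] S := e.symm.toLinearMap ∘ₗ
    j'.codRestrict (LinearMap.range (g ∘ₗ j)) fun x => hle (LinearMap.mem_range_self j' x)
  have hφ : φ ≠ 0 := by
    intro h0
    obtain ⟨s', hs'⟩ := exists_ne (0 : S')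
    have h1 : φ s' = 0 := by rw [h0]; rfl
    have h2 := (LinearEquiv.map_eq_zero_iff e.symm).1 h1
    exact hs' (hj' ((congrArg Subtype.val h2).trans (map_zero j').symm))
  exact ⟨(LinearEquiv.ofBijective φ (LinearMap.bijective_of_ne_zero hφ)).symm⟩

/-- Isomorphism of the simple quotients by maximal left ideals. -/
def maximalIdealSetoid (R : Type u) [Ring R] : Setoid {m : Ideal R // m.IsMaximal} where
  r m n := Nonempty ((R ⧸ m.1) ≃ₗ[R] (R ⧸ n.1))
  iseqv :=
    { refl := fun _ => ⟨LinearEquiv.refl _ _⟩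
      symm := fun ⟨e⟩ => ⟨e.symm⟩
      trans := fun ⟨e⟩ ⟨e'⟩ => ⟨e.trans e'⟩ }

theorem isSimpleModule_quotient_of_isMaximal {m : Ideal R} (hm : m.IsMaximal) :
    IsSimpleModule R (R ⧸ m) :=
  isSimpleModule_iff_isCoatom.2 hm.out

/-- Each `R ⧸ m` is a factor of a fixed composition series of `R`, namely at the first step where
the series leaves `m`. -/
theorem finite_quotient_maximalIdealSetoid [IsArtinianRing R] :
    Finite (Quotient (maximalIdealSetoid R)) := by
  classical
  obtain ⟨f, f0, n, hn, hcov⟩ := exists_covBy_seq_of_wellFoundedLT_wellFoundedGT (Ideal R)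
  have hidx (m : {m : Ideal R // m.IsMaximal}) : ∃ i : Fin n, f i ≤ m.1 ∧ ¬ f (i + 1) ≤ m.1 := by
    have hex : ∃ i, ¬ f i ≤ m.1 :=
      ⟨n, fun hle => m.2.ne_top (top_le_iff.1 (hn.eq_top ▸ hle))⟩
    have h0 : Nat.find hex ≠ 0 := fun h0 => by
      have := Nat.find_spec hex
      rw [h0, f0.eq_bot] at this
      exact this bot_le
    obtain ⟨i, hi⟩ := Nat.exists_eq_succ_of_ne_zero h0
    have hle : Nat.find hex ≤ n :=
      Nat.find_min' hex fun hle => m.2.ne_top (top_le_iff.1 (hn.eq_top ▸ hle))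
    refine ⟨⟨i, by omega⟩, not_not.1 (Nat.find_min hex (m := i) (by omega)), ?_⟩
    have := Nat.find_spec hex
    rwa [hi] at this
  choose idx hidx1 hidx2 using hidx
  refine Finite.of_injective (fun q : Quotient (maximalIdealSetoid R) => idx q.out) fun q q' hqq => ?_
  have key (m : {m : Ideal R // m.IsMaximal}) (i : Fin n) (hi : idx m = i) :
      Nonempty ((f (i + 1) ⧸ Submodule.comap (f (i + 1)).subtype (f i)) ≃ₗ[R] R ⧸ m.1) := by
    subst hi
    have := isSimpleModule_quotient_of_isMaximal m.2
    let p : f (idx m + 1) →ₗ[R] R ⧸ m.1 := m.1.mkQ ∘ₗ (f (idx m + 1)).subtype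
    have hp : p ≠ 0 := by
      intro h0
      refine hidx2 m fun x hx => (Submodule.Quotient.mk_eq_zero m.1).1 ?_
      exact LinearMap.congr_fun h0 ⟨x, hx⟩
    have hker : Submodule.comap (f (idx m + 1)).subtype (f (idx m)) = LinearMap.ker p := by
      have hinf : f (idx m + 1) ⊓ m.1 = f (idx m) := by
        refine ((hcov _ (idx m).2).eq_or_eq (le_inf (hcov _ (idx m).2).le (hidx1 m))
          inf_le_left).resolve_right fun heq => hidx2 m (inf_eq_left.1 heq)
      rw [LinearMap.ker_comp, Submodule.ker_mkQ, ← hinf]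
      ext x
      simp
    exact ⟨(Submodule.quotEquivOfEq _ _ hker).trans
      (p.quotKerEquivOfSurjective (LinearMap.surjective_of_ne_zero hp))⟩
  obtain ⟨e⟩ := key q.out _ rfl
  obtain ⟨e'⟩ := key q'.out _ hqq.symm
  rw [← q.out_eq, ← q'.out_eq]
  exact Quotient.sound ⟨e.symm.trans e'⟩

/-- Over a left artinian left FGF-ring, every simple module is a quotient of a projective
injective module. -/
theorem exists_projective_injective_quotient [IsArtinianRing R] (h : IsLeftFGF R) {m : Ideal R}
    (hm : m.IsMaximal) : ∃ (U : Type u) (_ : AddCommGroup U) (_ : Module R U),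
      Module.Injective R U ∧ Module.Projective R U ∧ ∃ f : U →ₗ[R] R ⧸ m, f ≠ 0 := by
  have hs (m : {m : Ideal R // m.IsMaximal}) : IsSimpleModule R (R ⧸ m.1) :=
    isSimpleModule_quotient_of_isMaximal m.2
  choose U iU iU' hU hUi hUp hUe using fun m : {m : Ideal R // m.IsMaximal} =>
    exists_projective_injective_essentiallyEmbeds h (R ⧸ m.1)
  have htop (m : {m : Ideal R // m.IsMaximal}) :
      ∃ (t : {m : Ideal R // m.IsMaximal}) (f : U m →ₗ[R] R ⧸ t.1), f ≠ 0 := by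
    have : Nontrivial (U m) := by
      obtain ⟨j, hj, -⟩ := hUe m
      have := IsSimpleModule.nontrivial R (R ⧸ m.1)
      exact hj.nontrivial
    obtain ⟨K, hK, -⟩ := (eq_top_or_exists_le_coatom (⊥ : Submodule R (U m))).resolve_left
      bot_ne_top
    have hsK : IsSimpleModule R (U m ⧸ K) := isSimpleModule_iff_isCoatom.2 hK
    obtain ⟨t, ht, ⟨e⟩⟩ := isSimpleModule_iff_quot_maximal.1 hsK
    refine ⟨⟨t, ht⟩, e.toLinearMap ∘ₗ K.mkQ, fun h0 => hK.1 (eq_top_iff.2 fun x _ => ?_)⟩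
    have h1 : e (K.mkQ x) = 0 := LinearMap.congr_fun h0 x
    exact (Submodule.Quotient.mk_eq_zero K).1 ((LinearEquiv.map_eq_zero_iff e).1 h1)
  choose τ f hf using htop
  have := finite_quotient_maximalIdealSetoid (R := R)
  -- `σ` sends a simple `S` to a chosen simple quotient of `U(S)`. It is injective because a common
  -- quotient forces isomorphic socles, hence surjective by finiteness.
  let σ : Quotient (maximalIdealSetoid R) → Quotient (maximalIdealSetoid R) :=
    fun q => Quotient.mk _ (τ q.out)
  have hσ : Function.Injective σ := by
    intro q q' hqq
    obtain ⟨e⟩ := Quotient.exact hqq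
    have hne : e.toLinearMap ∘ₗ f q.out ≠ 0 := by
      intro h0
      refine hf q.out (LinearMap.ext fun x => ?_)
      exact (LinearEquiv.map_eq_zero_iff e).1 (LinearMap.congr_fun h0 x)
    rw [← q.out_eq, ← q'.out_eq]
    exact Quotient.sound ((hUe q.out).nonempty_linearEquiv (hUe q'.out) hne (hf q'.out))
  obtain ⟨q, hq⟩ := Finite.injective_iff_surjective.1 hσ (Quotient.mk _ ⟨m, hm⟩)
  obtain ⟨e⟩ := Quotient.exact hq
  refine ⟨U q.out, _, _, hUi _, hUp _, e.toLinearMap ∘ₗ f q.out, fun h0 => ?_⟩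
  refine hf q.out (LinearMap.ext fun x => ?_)
  exact (LinearEquiv.map_eq_zero_iff e).1 (LinearMap.congr_fun h0 x)

theorem injective_prod {V W : Type u} [AddCommGroup V] [Module R V] [AddCommGroup W] [Module R W]
    [Module.Injective R V] [Module.Injective R W] : Module.Injective R (V × W) := by
  refine ⟨fun X Y _ _ _ _ f hf g => ?_⟩
  obtain ⟨a, ha⟩ := Module.Injective.out f hf (LinearMap.fst R V W ∘ₗ g)
  obtain ⟨b, hb⟩ := Module.Injective.out f hf (LinearMap.snd R V W ∘ₗ g)
  exact ⟨a.prod b, fun x => Prod.ext (ha x) (hb x)⟩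

/-- Take a maximal left ideal among images of injective modules. If it lay in a maximal `m`, a
projective injective module mapping onto `R ⧸ m` would lift to `R` and enlarge it. So an injective
module maps onto `R`, and the map splits. -/
theorem IsLeftFGF.injective_of_isArtinianRing [IsArtinianRing R] (h : IsLeftFGF R) :
    Module.Injective R R := by
  obtain ⟨I, ⟨V, _, _, hV, g, rfl⟩, hmax⟩ := set_has_maximal_iff_noetherian.2
    (inferInstance : IsNoetherian R R)
    {I : Ideal R | ∃ (V : Type u) (_ : AddCommGroup V) (_ : Module R V),
      Module.Injective R V ∧ ∃ g : V →ₗ[R] R, I = LinearMap.range g}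
    ⟨_, PUnit, inferInstance, inferInstance,
      ⟨fun _ _ _ _ _ _ _ _ _ => ⟨0, fun _ => rfl⟩⟩, 0, rfl⟩
  have htop : LinearMap.range g = ⊤ := by
    by_contra hne
    obtain ⟨m, hm, hle⟩ := Ideal.exists_le_maximal (LinearMap.range g) hne
    obtain ⟨U, _, _, hUi, hUp, f, hf⟩ := exists_projective_injective_quotient h hm
    obtain ⟨k, hk⟩ := Module.projective_lifting_property m.mkQ f m.mkQ_surjective
    refine hmax _ ⟨V × U, inferInstance, inferInstance, injective_prod, g.coprod k, rfl⟩ ?_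
    rw [LinearMap.range_coprod]
    refine left_lt_sup.2 fun hkg => hf (LinearMap.ext fun x => ?_)
    rw [← hk]
    exact (Submodule.Quotient.mk_eq_zero m).2 (hle (hkg (LinearMap.mem_range_self k x)))
  obtain ⟨s, hs⟩ := Module.projective_lifting_property g LinearMap.id (LinearMap.range_eq_top.1 htop)
  refine ⟨fun X Y _ _ _ _ i hi φ => ?_⟩
  obtain ⟨ψ, hψ⟩ := Module.Injective.out i hi (s ∘ₗ φ)
  exact ⟨g ∘ₗ ψ, fun x => by
    rw [LinearMap.comp_apply, hψ]
    exact LinearMap.congr_fun hs (φ x)⟩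

end InjectiveHulls

end RingModule

/-! ### The equivalences -/

theorem mainTheorem10 (R : Type u) [Ring R] (hnoeth : IsNoetherianRing R)
    (hFGF : RingModule.IsLeftFGF R) :
    List.TFAE
      [RingModule.IsQF R,
       RingModule.IsWQF R,
       RingModule.IsFPInjective R R,
       RingModule.IsRightKasch R,
       RingModule.IsSemiregular R,
       RingModule.IsSemiartinian R ∨ RingModule.IsSemiartinian Rᵐᵒᵖ,
       RingModule.IsEssential (RingModule.socle R R)] := by
  have hQF (hi : Module.Injective R R) : RingModule.IsQF R := hFGF.isQF_of_injective
  have hart (hR : RingModule.IsQF R) : IsArtinianRing R :=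
    have := hR.1.2
    hFGF.isArtinianRing_of_injective
  have hQF' (ha : IsArtinianRing R) : RingModule.IsQF R := hQF hFGF.injective_of_isArtinianRing
  tfae_have 1 → 2 := hFGF.isWQF_of_isQF
  tfae_have 2 → 1 := fun h => hQF h.injective
  tfae_have 1 → 3 := fun h =>
    have := h.1.2
    RingModule.isFPInjective_of_injective
  tfae_have 3 → 1 := fun h => hQF (RingModule.injective_of_isFPInjective h)
  tfae_have 1 → 4 := RingModule.IsQF.isRightKasch
  tfae_have 4 → 1 := fun h => hQF (hFGF.injective_of_isRightKasch h)
  tfae_have 1 → 5 := fun h => by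
    have := h.1.2
    have := RingModule.isSemisimpleRing_quotient_jacobson_of_injective (R := R)
    exact RingModule.exists_mul_mul_eq_of_isSemisimpleRing
  tfae_have 5 → 1 := fun h => by
    have : IsNoetherianRing (R ⧸ Ring.jacobson R) :=
      isNoetherianRing_of_surjective _ _ (Ideal.Quotient.mk _) Ideal.Quotient.mk_surjective
    exact hQF' (hFGF.isArtinianRing_of_isSemisimpleRing (RingModule.isSemisimpleRing_of_regular h))
  tfae_have 1 → 7 := fun h =>
    have := hart h
    RingModule.isEssential_socle_of_isArtinian
  tfae_have 7 → 6 := fun h => Or.inl (hFGF.isSemiartinian_of_isEssential_socle h)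
  tfae_have 6 → 1 := by
    rintro (h | h)
    · exact hQF' h.isArtinianRing
    · exact hQF' (hFGF.isArtinianRing_of_isSemisimpleRing h.isSemisimpleRing_quotient_jacobson)
  tfae_finish
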